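/- Let $d\ge 1$ and let $0\le\rho\in L^1(\mathbb{R}^d)$ be such that $N:=\int_{\mathbb{R}^d}\rho(x)\,\mathrm{d}x$ is a non-negative integer. An $N$-particle state of density $\rho$ is a Borel probability measure $\mathbb{P}$ on $(\mathbb{R}^d)^N$ that is invariant under permutations of the $N$ particles and whose one-body density (the sum of its $N$ marginals on $\mathbb{R}^d$) is $\rho(x)\,\mathrm{d}x$. 1. There exist an $N$-particle state $\mathbb{P}$ of density $\rho$ and a number $\delta>0$ such that, $\mathbb{P}$-almost surely, $|x_j-x_k|\ge\delta$ for all $j\ne k$. For the remaining claims, let $w:\mathbb{R}^d\to\mathbb{R}\cup\{+\infty\}$ be even and lower semi-continuous, and suppose that for some $\kappa>0$: * (stability) $\sum_{1\le j<k\le n}w(x_j-x_k)\ge-\kappa n$ for all $n\in\mathbb{N}$ and $x_1,\dots,x_n\in\mathbb{R}^d$; * (upper regularity without hard core) for some $r_0\ge0$, $0\le\alpha<\infty$ and $s>d$, $$w(x)\le\kappa\Big(\mathbf{1}(|x|<r_0)\Big(\frac{r_0}{|x|}\Big)^{\alpha}+\frac1{1+|x|^s}\Big)\qquad\text{for all }x\in\mathbb{R}^d,$$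 where, for $r_0>0$, $(r_0/|x|)^\alpha$ at $x=0$ is $+\infty$ if $\alpha>0$ and $1$ if $\alpha=0$. For an $N$-particle state $\mathbb{P}$ let $\mathcal{S}_N(\mathbb{P})=-\int_{(\mathbb{R}^d)^N}\mathbb{P}(x)\log\big(N!\,\mathbb{P}(x)\big)\,\mathrm{d}x$ if $\mathbb{P}$ is absolutely continuous with density $\mathbb{P}(x)$, and $\mathcal{S}_N(\mathbb{P})=-\infty$ otherwise. For $T\ge0$ (assuming $\int_{\mathbb{R}^d}\rho|\log\rho|<\infty$ if $T>0$) let $$F_T[\rho]=\inf_{\mathbb{P}}\Big\{\int_{(\mathbb{R}^d)^N}\sum_{1\le j<k\le N}w(x_j-x_k)\,\mathrm{d}\mathbb{P}(x_1,\dots,x_N)-T\,\mathcal{S}_N(\mathbb{P})\Big\},$$ where the infimum is over all $N$-particle states of density $\rho$ and the entropy term is absent for $T=0$. 2. For every such $w$, $F_0[\rho]<\infty$. 3. If in addition $\int_{\mathbb{R}^d}\rho|\log\rho|<\infty$, then the measure $\mathbb{P}$ in 1 can be chosen so that moreover $\mathcal{S}_N(\mathbb{P})$ is finite, and $F_T[\rho]<\infty$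 for every such $w$ and every $T>0$. -/

import Mathlib

open MeasureTheory Set
open scoped ENNReal Nat

noncomputable section

namespace ClassicalGas

/-- The one-particle space `ℝ^d` with its Euclidean norm and Lebesgue measure. -/
abbrev Space (d : ℕ) : Type := EuclideanSpace ℝ (Fin d)

/-- The space `(ℝ^d)^N` of configurations of `N` particles; its `volume` is Lebesgue measure. -/
abbrev Config (d N : ℕ) : Type := Fin N → Space d

/-- The integral of an extended real function, as the integral of the positive part minus the
integral of the negative part. It is meaningful as soon as one of the two is finite. -/
def eintegral {Ω : Type*} [MeasurableSpace Ω] (μ : Measure Ω) (f : Ω → EReal) : EReal :=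
  ((∫⁻ x, (f x).toENNReal ∂μ : ℝ≥0∞) : EReal) - ((∫⁻ x, (-f x).toENNReal ∂μ : ℝ≥0∞) : EReal)

/-- The interaction energy `∑_{j < k} w (x_j - x_k)` of a configuration. -/
def pairEnergy {d N : ℕ} (w : Space d → EReal) (x : Config d N) : EReal :=
  ∑ j : Fin N, ∑ k ∈ Finset.Ioi j, w (x j - x k)

/-- Stability of the pair potential with constant `κ`. -/
def IsStable {d : ℕ} (w : Space d → EReal) (κ : ℝ) : Prop :=
  ∀ (N : ℕ) (x : Config d N), ((-(κ * N) : ℝ) : EReal) ≤ pairEnergy w x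

/-- The singular profile `1(|x| < r₀) (r₀ / |x|) ^ α` with `0 ≤ α ≤ ∞`. It is `+∞` on the whole
ball `|x| < r₀` if `α = ∞`; at `x = 0` it is `+∞` if `0 < α` and `1` if `α = 0` (`r₀ > 0`). -/
def coreProfile {d : ℕ} (r₀ : ℝ) (α : ℝ≥0∞) (x : Space d) : ℝ≥0∞ :=
  if ‖x‖ < r₀ then
    if α = ⊤ then ⊤ else (ENNReal.ofReal r₀ / ENNReal.ofReal ‖x‖) ^ α.toReal
  else 0

/-- Upper regularity of the pair potential with constant `κ` and core exponent `α`. -/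
def IsUpperRegular {d : ℕ} (w : Space d → EReal) (κ : ℝ) (α : ℝ≥0∞) : Prop :=
  ∃ r₀ s : ℝ, 0 ≤ r₀ ∧ (d : ℝ) < s ∧ ∀ x : Space d,
    w x ≤ ((ENNReal.ofReal κ *
      (coreProfile r₀ α x + ENNReal.ofReal (1 / (1 + ‖x‖ ^ s))) : ℝ≥0∞) : EReal)

/-- Short-range potentials `w : ℝ^d → ℝ ∪ {+∞}` with core exponent `α`. -/
structure IsShortRange {d : ℕ} (w : Space d → EReal) (α : ℝ≥0∞) : Prop where
  ne_bot : ∀ x, w x ≠ ⊥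
  even : ∀ x, w (-x) = w x
  lsc : LowerSemicontinuous w
  bounds : ∃ κ : ℝ, 0 < κ ∧ IsStable w κ ∧ IsUpperRegular w κ α

/-- Invariance of an `N`-particle measure under permutations of the particles. -/
def IsSymmetric {d N : ℕ} (P : Measure (Config d N)) : Prop :=
  ∀ (σ : Equiv.Perm (Fin N)) (A : Fin N → Set (Space d)), (∀ i, MeasurableSet (A i)) →
    P (univ.pi fun i => A (σ i)) = P (univ.pi A)

/-- The one-body density of `P`, as a measure: the sum of the `N` marginals (which is `N` times
the first marginal if `P` is symmetric). -/
def oneBody {d N : ℕ} (P : Measure (Config d N)) : Measure (Space d) :=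
  ∑ i : Fin N, P.map fun x => x i

/-- `P` is a symmetric `N`-particle probability measure whose one-body density is `ρ`. -/
structure IsStateOf {d N : ℕ} (ρ : Space d → ℝ) (P : Measure (Config d N)) : Prop where
  prob : IsProbabilityMeasure P
  symm : IsSymmetric P
  density : oneBody P = (volume : Measure (Space d)).withDensity fun x => ENNReal.ofReal (ρ x)

/-- Distinct particles are `P`-almost surely at distance at least `δ` from each other. -/
def IsSeparated {d N : ℕ} (P : Measure (Config d N)) (δ : ℝ) : Prop :=
  ∀ᵐ x ∂P, ∀ j k : Fin N, j ≠ k → δ ≤ ‖x j - x k‖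

/-- The average interaction energy of `P`. -/
def interaction {d N : ℕ} (w : Space d → EReal) (P : Measure (Config d N)) : EReal :=
  eintegral P fun x => pairEnergy w x

/-- The Lebesgue density of `P` on `(ℝ^d)^N` (used for `P` absolutely continuous). -/
def lebDensity {d N : ℕ} (P : Measure (Config d N)) (x : Config d N) : ℝ :=
  (P.rnDeriv volume x).toReal

open Classical in
/-- The entropy `-∫ P log (N! P)`, equal to `-∞` if `P` is not absolutely continuous. -/
def entropy {d N : ℕ} (P : Measure (Config d N)) : EReal :=
  if P ≪ volume then
    -eintegral volume fun x : Config d N =>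
      ((lebDensity P x * Real.log ((N ! : ℝ) * lebDensity P x) : ℝ) : EReal)
  else ⊥

/-- The free energy of `P` at temperature `T`. In `EReal` one has `0 * a = 0` for every `a`, so
that the entropy term disappears at `T = 0`. -/
def freeEnergy {d N : ℕ} (w : Space d → EReal) (T : ℝ) (P : Measure (Config d N)) : EReal :=
  interaction w P - (T : EReal) * entropy P

theorem freeEnergy_zero {d N : ℕ} (w : Space d → EReal) (P : Measure (Config d N)) :
    freeEnergy w 0 P = interaction w P := by
  simp [freeEnergy]

/-- The minimal free energy `F_T[ρ]` of `N` particles with one-body density `ρ`. -/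
def minFreeEnergy {d : ℕ} (N : ℕ) (w : Space d → EReal) (T : ℝ) (ρ : Space d → ℝ) : EReal :=
  ⨅ (P : Measure (Config d N)) (_ : IsStateOf ρ P), freeEnergy w T P

end ClassicalGas

end

noncomputable section

namespace ClassicalGas


/-! Hyperplanes orthogonal to one axis cut `ρ` into `2N` slabs of mass `1/2` (`exists_slabs`). Slabs
that are not neighbours lie at positive distance, so putting one particle in each even slab,
independently with law `2ρ` restricted to it, gives a separated configuration; likewise for the odd
slabs. Averaging the two choices and symmetrizing (`permMixture`) restores the density `ρ`.

On separated configurations `w` is bounded above, whence finite energy (`interaction_lt_top`). The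
Lebesgue density is `ρ ⊗ ⋯ ⊗ ρ` times a factor with finitely many values, so integrability of `ρ
|log ρ|` gives finite entropy (`entropy_ne_bot_top`). -/

/-! ### Densities of product measures. -/

/-- Tonelli's theorem for a product of functions of one variable each. -/
theorem lintegral_pi_fin_prod {n : ℕ} {E : Type*} [MeasurableSpace E] (μ : Fin n → Measure E)
    [∀ i, SigmaFinite (μ i)] (f : Fin n → E → ℝ≥0∞) (hf : ∀ i, Measurable (f i)) :
    ∫⁻ x, ∏ i, f i (x i) ∂Measure.pi μ = ∏ i, ∫⁻ y, f i y ∂μ i := by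
  induction n with
  | zero => simp
  | succ n ih =>
    have hm : Measurable fun z : Fin n → E => ∏ i, f i.succ (z i) :=
      Finset.measurable_prod _ fun i _ => (hf _).comp (measurable_pi_apply i)
    rw [← ((measurePreserving_piFinSuccAbove μ 0).symm).lintegral_comp_emb
      (MeasurableEquiv.measurableEmbedding _)]
    simp only [MeasurableEquiv.piFinSuccAbove_symm_apply, Fin.insertNthEquiv, Fin.prod_univ_succ,
      Fin.insertNth_zero, Equiv.coe_fn_mk, Fin.cons_succ, Fin.cons_zero, Fin.zero_succAbove, cast_eq]
    rw [lintegral_prod_mul (hf 0).aemeasurable hm.aemeasurable, ih _ _ fun i => hf i.succ]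

theorem pi_withDensity {n : ℕ} {E : Type*} [MeasurableSpace E] (μ : Measure E) [SigmaFinite μ]
    (f : Fin n → E → ℝ≥0∞) (hf : ∀ i, Measurable (f i))
    [∀ i, SigmaFinite (μ.withDensity (f i))] :
    Measure.pi (fun i => μ.withDensity (f i)) =
      (Measure.pi fun _ => μ).withDensity fun x => ∏ i, f i (x i) := by
  refine Measure.pi_eq fun s hs => ?_
  rw [withDensity_apply _ (MeasurableSet.univ_pi hs), Measure.restrict_pi_pi,
    lintegral_pi_fin_prod _ f hf]
  exact Finset.prod_congr rfl fun i _ => (withDensity_apply _ (hs i)).symm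

/-! ### Slicing space by quantiles of one coordinate. -/

/-- A finite atomless measure on the line has quantiles. -/
theorem exists_measure_Iic_eq (ν : Measure ℝ) [IsFiniteMeasure ν] [NullSingletonClass ν] {c : ℝ}
    (hc : 0 < c) (hc' : c < ν.real univ) : ∃ t, ν.real (Iic t) = c := by
  have hcont : Continuous fun t => ν.real (Iic t) := by
    -- Up to a constant, the distribution function is the primitive of `1` against `ν`, continuous
    -- because `ν` has no atoms.
    have h := (integrable_const (1 : ℝ) (μ := ν)).continuous_primitive 0
    have h2 : (fun t => ν.real (Iic t)) = fun t => (∫ _ in (0 : ℝ)..t, (1 : ℝ) ∂ν) +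
        ν.real (Iic 0) := by
      ext t
      rw [← intervalIntegral.integral_Iic_sub_Iic (integrable_const _).integrableOn
        (integrable_const _).integrableOn]
      simp
    rw [h2]
    exact h.add_const _
  have htop : Filter.Tendsto (fun t => ν.real (Iic t)) Filter.atTop (nhds (ν.real univ)) :=
    (ENNReal.tendsto_toReal (measure_ne_top _ _)).comp (tendsto_measure_Iic_atTop ν)
  have hbot : Filter.Tendsto (fun t => ν.real (Ici t)) Filter.atBot (nhds (ν.real univ)) :=
    (ENNReal.tendsto_toReal (measure_ne_top _ _)).comp (tendsto_measure_Ici_atBot ν)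
  obtain ⟨a, ha⟩ := (hbot.eventually_const_lt (show ν.real univ - c < _ by linarith)).exists
  obtain ⟨b, hb⟩ := (htop.eventually_const_lt hc').exists
  refine mem_range_of_exists_le_of_exists_ge hcont ⟨a, ?_⟩ ⟨b, hb.le⟩
  have h1 : ν.real (Ioi a) = ν.real (Ici a) := measureReal_congr Ioi_ae_eq_Ici
  have h2 := measureReal_add_measureReal_compl (μ := ν) (measurableSet_Iic (a := a))
  rw [compl_Iic, h1] at h2
  linarith

/-- Ensures that the law of one coordinate under `μ ≪ volume` has no atoms. -/
theorem volume_coordinate_eq {d : ℕ} (i : Fin d) (c : ℝ) :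
    (volume : Measure (Space d)) {x | x i = c} = 0 := by
  have h := (PiLp.volume_preserving_ofLp (Fin d)).measure_preimage
    (s := {y : Fin d → ℝ | y i = c})
    (measurableSet_eq_fun (measurable_pi_apply i) measurable_const).nullMeasurableSet
  rw [volume_pi, Measure.pi_hyperplane] at h
  exact h

/-- An increasing family of half-spaces whose measures grow by `1/2`, at positive distance from
the complements of their successors. -/
theorem exists_layers {d : ℕ} (hd : 1 ≤ d) (N : ℕ) (μ : Measure (Space d)) (hμ : μ ≪ volume)
    (hN : μ univ = N) :
    ∃ A : ℕ → Set (Space d), (∀ k, MeasurableSet (A k)) ∧ A 0 = ∅ ∧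
      (∀ k ≤ 2 * N, μ.real (A k) = k / 2) ∧
      ∃ δ : ℝ, 0 < δ ∧ ∀ k < 2 * N, ∀ x ∈ A k, ∀ y ∉ A (k + 1), δ ≤ ‖x - y‖ := by
  have : IsFiniteMeasure μ := ⟨by simp [hN]⟩
  let i₀ : Fin d := ⟨0, hd⟩
  let π : Space d → ℝ := fun x => x i₀
  have hπ : Measurable π := by fun_prop
  let ν := μ.map π
  have hν : NullSingletonClass ν := ⟨fun c => by
    rw [Measure.map_apply hπ (measurableSet_singleton c)]
    exact hμ (volume_coordinate_eq i₀ c)⟩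
  have hνN : ν.real univ = N := by
    simp [ν, Measure.real, Measure.map_apply hπ MeasurableSet.univ, hN]
  have hex : ∀ k : ℕ, ∃ t, 0 < k → k < 2 * N → ν.real (Iic t) = k / 2 := by
    intro k
    by_cases hk : 0 < k ∧ k < 2 * N
    · obtain ⟨t, ht⟩ := exists_measure_Iic_eq ν (c := k / 2) (by have := hk.1; positivity) (by
        rw [hνN]
        have : (k : ℝ) < 2 * N := mod_cast hk.2
        linarith)
      exact ⟨t, fun _ _ => ht⟩
    · exact ⟨0, fun h1 h2 => absurd ⟨h1, h2⟩ hk⟩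
  choose t ht using hex
  -- The end layers are `∅` and `univ`: the masses `0` and `N` need not be attained at a finite
  -- threshold.
  let A : ℕ → Set (Space d) := fun k =>
    if k = 0 then ∅ else if k < 2 * N then π ⁻¹' Iic (t k) else univ
  have hA0 : A 0 = ∅ := by simp [A]
  have hlt : ∀ k, 0 < k → k + 1 < 2 * N → t k < t (k + 1) := by
    intro k h0 h1
    by_contra! h
    have h2 := measureReal_mono (μ := ν) (Iic_subset_Iic.2 h)
    rw [ht _ h0 (by omega), ht _ (by omega) h1] at h2
    push_cast at h2
    linarith
  -- `δ` is a lower bound for finitely many positive gaps, and `1` if there are none.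
  obtain ⟨δ, hδ, hδt⟩ : ∃ δ : ℝ, 0 < δ ∧
      ∀ k ∈ Finset.range (2 * N), 0 < k → k + 1 < 2 * N → δ ≤ t (k + 1) - t k := by
    induction Finset.range (2 * N) using Finset.induction_on with
    | empty => exact ⟨1, one_pos, by simp⟩
    | insert a s _ ih =>
      obtain ⟨δ, hδ, h⟩ := ih
      by_cases ha : 0 < a ∧ a + 1 < 2 * N
      · refine ⟨min δ (t (a + 1) - t a), lt_min hδ (sub_pos.2 (hlt a ha.1 ha.2)), ?_⟩
        intro k hk h0 h1
        rcases Finset.mem_insert.1 hk with rfl | hk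
        · exact min_le_right _ _
        · exact (min_le_left _ _).trans (h k hk h0 h1)
      · refine ⟨δ, hδ, fun k hk h0 h1 => ?_⟩
        rcases Finset.mem_insert.1 hk with rfl | hk
        · exact absurd ⟨h0, h1⟩ ha
        · exact h k hk h0 h1
  refine ⟨A, fun k => ?_, hA0, fun k hk => ?_, δ, hδ, fun k hk x hx y hy => ?_⟩
  · dsimp only [A]
    split_ifs
    exacts [MeasurableSet.empty, hπ measurableSet_Iic, MeasurableSet.univ]
  · dsimp only [A]
    split_ifs with h1 h2
    · simp [h1]
    · rw [← ht k (by omega) h2, map_measureReal_apply hπ measurableSet_Iic]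
    · obtain rfl : k = 2 * N := by omega
      simp [Measure.real, hN]
  -- No point lies in `A 0` or outside `A (2 * N)`, so only gaps between genuine thresholds matter.
  · have h0 : k ≠ 0 := by rintro rfl; simp [hA0] at hx
    have h1 : k + 1 < 2 * N := by by_contra h; simp [A, h] at hy
    simp only [A, h0, hk, if_true, if_false, mem_preimage, mem_Iic] at hx
    simp only [A, h1, Nat.succ_ne_zero, if_true, if_false, mem_preimage, mem_Iic, not_le] at hy
    have h2 : ‖(x - y) i₀‖ ≤ ‖x - y‖ := PiLp.norm_apply_le _ _
    have h3 := hδt k (Finset.mem_range.2 hk) (by omega) h1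
    have h4 : -(x i₀ - y i₀) ≤ ‖(x - y) i₀‖ := neg_le_abs _
    have hx' : x i₀ ≤ t k := hx
    have hy' : t (k + 1) < y i₀ := hy
    linarith


/-- Consecutive slabs of mass `1/2`, any two of which are at positive distance unless they are
neighbours. -/
theorem exists_slabs {d : ℕ} (hd : 1 ≤ d) (N : ℕ) (μ : Measure (Space d)) (hμ : μ ≪ volume)
    (hN : μ univ = N) :
    ∃ S : ℕ → Set (Space d), (∀ k, MeasurableSet (S k)) ∧ (∀ k < 2 * N, μ (S k) = 2⁻¹) ∧
      ∑ k ∈ Finset.range (2 * N), μ.restrict (S k) = μ ∧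
      ∃ δ : ℝ, 0 < δ ∧ ∀ j k, j + 2 ≤ k → k < 2 * N → ∀ x ∈ S j, ∀ y ∈ S k, δ ≤ ‖x - y‖ := by
  have : IsFiniteMeasure μ := ⟨by simp [hN]⟩
  obtain ⟨A, hA, hA0, hμA, δ, hδ, hsep⟩ := exists_layers hd N μ hμ hN
  have hmono : ∀ k < 2 * N, A k ⊆ A (k + 1) := by
    intro k hk x hx
    -- Such a point would be at distance at least `δ` from itself.
    by_contra hx'
    have := hsep k hk x hx x hx'
    simp at this
    linarith
  have hreal : ∀ k < 2 * N, μ.real (A (k + 1) \ A k) = 1 / 2 := by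
    intro k hk
    rw [measureReal_sdiff (hmono k hk) (hA k), hμA _ hk, hμA _ hk.le]
    push_cast
    ring
  refine ⟨fun k => A (k + 1) \ A k, fun k => (hA _).diff (hA _), fun k hk => ?_, ?_, δ, hδ, ?_⟩
  · rw [← ofReal_measureReal, hreal k hk]
    simp
  · have hsum : ∀ n ≤ 2 * N,
        ∑ k ∈ Finset.range n, μ.restrict (A (k + 1) \ A k) = μ.restrict (A n) := by
      intro n
      induction n with
      | zero => simp [hA0]
      | succ n ih =>
        intro hn
        rw [Finset.sum_range_succ, ih (by omega),
          ← Measure.restrict_union disjoint_sdiff_right ((hA _).diff (hA _)),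
          union_sdiff_cancel (hmono n (by omega))]
    rw [hsum _ le_rfl]
    refine Measure.restrict_eq_self_of_ae_mem ?_
    have h := measureReal_compl (μ := μ) (hA (2 * N))
    rw [hμA _ le_rfl, Measure.real, Measure.real, hN] at h
    rw [ae_iff]
    have h0 : (μ (A (2 * N))ᶜ).toReal = 0 := by
      rw [h]; push_cast; simp
    exact (ENNReal.toReal_eq_zero_iff _).1 h0 |>.resolve_right (measure_ne_top _ _)
  · intro j k hjk hk x hx y hy
    have hle : ∀ n, j + 1 ≤ n → n ≤ 2 * N → A (j + 1) ⊆ A n := by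
      intro n hn
      induction n, hn using Nat.le_induction with
      | base => exact fun _ => Subset.rfl
      | succ n _ ih => exact fun h => (ih (by omega)).trans (hmono n (by omega))
    -- The skipped slab gives `j + 1 ≤ n`: the lower slab lies inside `A n`, the upper one outside
    -- `A (n + 1)`.
    obtain ⟨n, rfl⟩ : ∃ n, k = n + 1 := ⟨k - 1, by omega⟩
    exact hsep n (by omega) x (hle n (by omega) (by omega) hx.1) y hy.2

/-! ### Symmetrized mixtures of product measures. -/

section Mixture

variable {ι : Type*} [Fintype ι] {d N : ℕ}

/-- The uniform mixture, over `m` and over all permutations of the particles, of the product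
measures `ν m 0 ⊗ ⋯ ⊗ ν m (N - 1)`. -/
def permMixture (ν : ι → Fin N → Measure (Space d)) : Measure (Config d N) :=
  ((Fintype.card ι * N ! : ℕ) : ℝ≥0∞)⁻¹ •
    ∑ m, ∑ σ : Equiv.Perm (Fin N), Measure.pi fun i => ν m (σ i)

theorem permMixture_apply (ν : ι → Fin N → Measure (Space d)) (A : Set (Config d N)) :
    permMixture ν A = ((Fintype.card ι * N ! : ℕ) : ℝ≥0∞)⁻¹ *
      ∑ m, ∑ σ : Equiv.Perm (Fin N), Measure.pi (fun i => ν m (σ i)) A := by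
  simp [permMixture]

theorem card_mul_factorial_ne_zero [Nonempty ι] : (Fintype.card ι * N ! : ℕ) ≠ 0 :=
  mul_ne_zero Fintype.card_ne_zero (Nat.factorial_ne_zero N)

theorem isProbabilityMeasure_permMixture [Nonempty ι] (ν : ι → Fin N → Measure (Space d))
    [∀ m i, IsProbabilityMeasure (ν m i)] : IsProbabilityMeasure (permMixture ν) := by
  refine ⟨?_⟩
  rw [permMixture_apply]
  simp only [measure_univ, Finset.sum_const, Finset.card_univ, Fintype.card_perm, Fintype.card_fin,
    nsmul_eq_mul, mul_one]
  rw [← Nat.cast_mul]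
  exact ENNReal.inv_mul_cancel (by exact_mod_cast card_mul_factorial_ne_zero)
    (ENNReal.natCast_ne_top _)

theorem isSymmetric_permMixture (ν : ι → Fin N → Measure (Space d))
    [∀ m i, SigmaFinite (ν m i)] : IsSymmetric (permMixture ν) := by
  intro σ A hA
  simp only [permMixture_apply, Measure.pi_pi]
  congr 1
  refine Finset.sum_congr rfl fun m _ => ?_
  -- Permuting the boxes only translates the sum over the group of permutations.
  rw [← Equiv.sum_comp (Equiv.mulRight σ)]
  refine Finset.sum_congr rfl fun τ _ => ?_
  rw [← Equiv.prod_comp σ (fun i => ν m (τ i) (A i))]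
  rfl

/-- For each permutation the particles visit every label once, so the `N!` terms contribute equally
and cancel the normalization. -/
theorem oneBody_permMixture (ν : ι → Fin N → Measure (Space d))
    [∀ m i, IsProbabilityMeasure (ν m i)] :
    oneBody (permMixture ν) = (Fintype.card ι : ℝ≥0∞)⁻¹ • ∑ m, ∑ i, ν m i := by
  ext s hs
  have key : ∀ (i : Fin N), (permMixture ν).map (fun x => x i) s =
      ((Fintype.card ι * N ! : ℕ) : ℝ≥0∞)⁻¹ *
        ∑ m, ∑ σ : Equiv.Perm (Fin N), ν m (σ i) s := by
    intro i
    rw [Measure.map_apply (measurable_pi_apply i) hs, permMixture_apply]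
    congr 1
    refine Finset.sum_congr rfl fun m _ => Finset.sum_congr rfl fun σ _ => ?_
    exact (measurePreserving_eval (fun i => ν m (σ i)) i).measure_preimage hs.nullMeasurableSet
  simp only [oneBody, Measure.coe_finsetSum, Finset.sum_apply, key, Measure.smul_apply,
    smul_eq_mul]
  rw [← Finset.mul_sum, Finset.sum_comm]
  have h2 : ∀ m, ∑ i, ∑ σ : Equiv.Perm (Fin N), ν m (σ i) s = (N ! : ℝ≥0∞) * ∑ i, ν m i s := by
    intro m
    rw [Finset.sum_comm]
    simp_rw [fun σ : Equiv.Perm (Fin N) => Equiv.sum_comp σ fun i => ν m i s]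
    simp [Fintype.card_perm]
  simp_rw [h2]
  rw [← Finset.mul_sum, ← mul_assoc]
  congr 1
  have hf : (N ! : ℝ≥0∞) ≠ 0 := by exact_mod_cast Nat.factorial_ne_zero N
  rw [Nat.cast_mul, ENNReal.mul_inv (Or.inr (by simp)) (Or.inr hf), mul_assoc,
    ENNReal.inv_mul_cancel hf (by simp), mul_one]

theorem ae_permMixture {ν : ι → Fin N → Measure (Space d)} {p : Config d N → Prop}
    (h : ∀ m (σ : Equiv.Perm (Fin N)), ∀ᵐ x ∂Measure.pi fun i => ν m (σ i), p x) :
    ∀ᵐ x ∂permMixture ν, p x := by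
  rw [ae_iff, permMixture_apply, mul_eq_zero]
  exact Or.inr (Finset.sum_eq_zero fun m _ => Finset.sum_eq_zero fun σ _ => ae_iff.1 (h m σ))

/-- A mixture of products of measures living on separated sets is separated. -/
theorem isSeparated_permMixture {ν : ι → Fin N → Measure (Space d)}
    [∀ m i, SigmaFinite (ν m i)] {S : ι → Fin N → Set (Space d)}
    (hS : ∀ m i, ∀ᵐ x ∂ν m i, x ∈ S m i) {δ : ℝ}
    (hδ : ∀ m i j, i < j → ∀ x ∈ S m i, ∀ y ∈ S m j, δ ≤ ‖x - y‖) :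
    IsSeparated (permMixture ν) δ := by
  refine ae_permMixture fun m σ => ?_
  have h : ∀ i, ∀ᵐ x ∂Measure.pi fun i => ν m (σ i), x i ∈ S m (σ i) := fun i =>
    (Measure.quasiMeasurePreserving_eval (μ := fun i => ν m (σ i)) i).ae (hS m (σ i))
  filter_upwards [ae_all_iff.2 h] with x hx j k hjk
  rcases lt_or_gt_of_ne (σ.injective.ne hjk) with hlt | hlt
  · exact hδ m _ _ hlt _ (hx j) _ (hx k)
  · rw [norm_sub_rev]
    exact hδ m _ _ hlt _ (hx k) _ (hx j)

/-- The factor by which the density of a mixture of products of truncations `c 1_S f` differs from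
`f ⊗ ⋯ ⊗ f`. -/
def mixtureFactor (S : ι → Fin N → Set (Space d)) (c : ℝ≥0∞) (x : Config d N) : ℝ≥0∞ :=
  ((Fintype.card ι * N ! : ℕ) : ℝ≥0∞)⁻¹ *
    ∑ m, ∑ σ : Equiv.Perm (Fin N), ∏ i, (S m (σ i)).indicator (fun _ => c) (x i)

theorem measurable_mixtureFactor {S : ι → Fin N → Set (Space d)} (hS : ∀ m i, MeasurableSet (S m i))
    (c : ℝ≥0∞) : Measurable (mixtureFactor S c) := by
  refine Measurable.const_mul (Finset.measurable_sum _ fun m _ => Finset.measurable_sum _ fun σ _ =>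
    Finset.measurable_prod _ fun i _ => ?_) _
  exact (measurable_const.indicator (hS m (σ i))).comp (measurable_pi_apply i)

theorem mixtureFactor_ne_top [Nonempty ι] (S : ι → Fin N → Set (Space d)) {c : ℝ≥0∞} (hc : c ≠ ⊤)
    (x : Config d N) : mixtureFactor S c x ≠ ⊤ := by
  refine ENNReal.mul_ne_top (ENNReal.inv_ne_top.2 (by exact_mod_cast card_mul_factorial_ne_zero)) ?_
  refine ENNReal.sum_ne_top.2 fun m _ => ENNReal.sum_ne_top.2 fun σ _ =>
    ENNReal.prod_ne_top fun i _ => ?_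
  by_cases h : x i ∈ S m (σ i) <;> simp [h, hc]

/-- The factor depends on `x` only through the finitely many truth values `x i ∈ S m j`. This is
what bounds its logarithm. -/
theorem finite_range_mixtureFactor (S : ι → Fin N → Set (Space d)) (c : ℝ≥0∞) :
    (range (mixtureFactor S c)).Finite := by
  classical
  let G : (ι → Fin N → Fin N → Prop) → ℝ≥0∞ := fun b =>
    ((Fintype.card ι * N ! : ℕ) : ℝ≥0∞)⁻¹ *
      ∑ m, ∑ σ : Equiv.Perm (Fin N), ∏ i, if b m (σ i) i then c else 0
  refine (finite_range G).subset ?_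
  rintro _ ⟨x, rfl⟩
  exact ⟨fun m j i => x i ∈ S m j, by simp [G, mixtureFactor, indicator_apply]⟩

/-- The product `∏ i, f (x i)` does not see the permutation or `m`, so it factors out of the
mixture. -/
theorem permMixture_eq_withDensity {f : Space d → ℝ≥0∞} (hf : Measurable f)
    {S : ι → Fin N → Set (Space d)} (hS : ∀ m i, MeasurableSet (S m i)) {c : ℝ≥0∞}
    {ν : ι → Fin N → Measure (Space d)} [∀ m i, SigmaFinite (ν m i)]
    (hν : ∀ m i, ν m i = c • (volume.withDensity f).restrict (S m i)) :
    permMixture ν = (volume : Measure (Config d N)).withDensity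
      fun x => mixtureFactor S c x * ∏ i, f (x i) := by
  have hh : ∀ m i, Measurable fun x => (S m i).indicator (fun _ => c) x * f x := fun m i =>
    (measurable_const.indicator (hS m i)).mul hf
  have hν' : ∀ m i, ν m i =
      volume.withDensity fun x => (S m i).indicator (fun _ => c) x * f x := by
    intro m i
    rw [hν, restrict_withDensity (hS m i), ← withDensity_smul _ hf, ← withDensity_indicator (hS m i)]
    congr 1
    ext x
    by_cases hx : x ∈ S m i <;> simp [hx]
  have hpi : ∀ m (σ : Equiv.Perm (Fin N)), Measure.pi (fun i => ν m (σ i)) =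
      (volume : Measure (Config d N)).withDensity
        fun x => (∏ i, (S m (σ i)).indicator (fun _ => c) (x i)) * ∏ i, f (x i) := by
    intro m σ
    have : ∀ i, SigmaFinite (volume.withDensity fun x =>
        (S m (σ i)).indicator (fun _ => c) x * f x) := fun i => hν' m (σ i) ▸ inferInstance
    simp_rw [hν']
    rw [pi_withDensity volume _ fun i => hh m (σ i)]
    simp_rw [Finset.prod_mul_distrib]
    rfl
  have hterm : ∀ m (σ : Equiv.Perm (Fin N)), Measurable fun x : Config d N =>
      (∏ i, (S m (σ i)).indicator (fun _ => c) (x i)) * ∏ i, f (x i) := by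
    intro m σ
    simp_rw [← Finset.prod_mul_distrib]
    exact Finset.measurable_prod _ fun i _ => (hh m (σ i)).comp (measurable_pi_apply i)
  ext A hA
  rw [permMixture_apply, withDensity_apply _ hA]
  simp_rw [hpi, withDensity_apply _ hA, mixtureFactor, mul_assoc, Finset.sum_mul]
  rw [lintegral_const_mul _ (Finset.measurable_sum _ fun m _ => Finset.measurable_sum _ fun σ _ =>
    hterm m σ), lintegral_finsetSum _ fun m _ => Finset.measurable_sum _ fun σ _ => hterm m σ]
  congr 1
  refine Finset.sum_congr rfl fun m _ => ?_
  rw [lintegral_finsetSum _ fun σ _ => hterm m σ]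

end Mixture


/-! ### Finiteness of entropy and interaction energy. -/

theorem lintegral_oneBody {d N : ℕ} (P : Measure (Config d N)) {u : Space d → ℝ≥0∞}
    (hu : Measurable u) : ∫⁻ y, u y ∂oneBody P = ∫⁻ x, ∑ i, u (x i) ∂P := by
  rw [oneBody, lintegral_finsetSum_measure, lintegral_finsetSum _ fun i _ => by fun_prop]
  exact Finset.sum_congr rfl fun i _ => lintegral_map hu (measurable_pi_apply i)

theorem eintegral_congr_ae {Ω : Type*} [MeasurableSpace Ω] {μ : Measure Ω} {f g : Ω → EReal}
    (h : f =ᵐ[μ] g) : eintegral μ f = eintegral μ g := by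
  unfold eintegral
  congr 2 <;> refine lintegral_congr_ae ?_ <;> filter_upwards [h] with x hx <;> rw [hx]

theorem eintegral_coe_ne_bot_top {Ω : Type*} [MeasurableSpace Ω] {μ : Measure Ω} {f : Ω → ℝ}
    (h : ∫⁻ x, ENNReal.ofReal |f x| ∂μ ≠ ⊤) :
    eintegral μ (fun x => (f x : EReal)) ≠ ⊥ ∧ eintegral μ (fun x => (f x : EReal)) ≠ ⊤ := by
  have h1 : ∫⁻ x, (f x : EReal).toENNReal ∂μ ≠ ⊤ := by
    refine ne_top_of_le_ne_top h (lintegral_mono fun x => ?_)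
    rw [EReal.toENNReal_of_ne_top (EReal.coe_ne_top _), EReal.toReal_coe]
    exact ENNReal.ofReal_le_ofReal (le_abs_self _)
  have h2 : ∫⁻ x, (-(f x : EReal)).toENNReal ∂μ ≠ ⊤ := by
    refine ne_top_of_le_ne_top h (lintegral_mono fun x => ?_)
    rw [← EReal.coe_neg, EReal.toENNReal_of_ne_top (EReal.coe_ne_top _), EReal.toReal_coe]
    exact ENNReal.ofReal_le_ofReal (neg_le_abs _)
  unfold eintegral
  rw [← ENNReal.ofReal_toReal h1, ← ENNReal.ofReal_toReal h2,
    EReal.coe_ennreal_ofReal, EReal.coe_ennreal_ofReal, ← EReal.coe_sub]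
  exact ⟨EReal.coe_ne_bot _, EReal.coe_ne_top _⟩

/-- A state whose Lebesgue density is `r ⊗ ⋯ ⊗ r` times a factor with finitely many values has
finite entropy as soon as `log r` is integrable against its one-body density. -/
theorem entropy_ne_bot_top {d N : ℕ} {P : Measure (Config d N)} [IsProbabilityMeasure P]
    {r : Space d → ℝ} (hr : Measurable r) (hr0 : ∀ x, 0 ≤ r x) {g : Config d N → ℝ≥0∞}
    (hg : Measurable g) (hgt : ∀ x, g x ≠ ⊤) (hgf : (range g).Finite)
    (hP : P = volume.withDensity fun x => g x * ∏ i, ENNReal.ofReal (r (x i)))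
    (hlog : ∫⁻ y, ENNReal.ofReal |Real.log (r y)| ∂oneBody P ≠ ⊤) :
    entropy P ≠ ⊥ ∧ entropy P ≠ ⊤ := by
  set p : Config d N → ℝ≥0∞ := fun x => g x * ∏ i, ENNReal.ofReal (r (x i)) with hp
  have hpm : Measurable p := hg.mul (Finset.measurable_prod _ fun i _ => by fun_prop)
  have hac : P ≪ volume := hP ▸ withDensity_absolutelyContinuous _ _
  have hleb : lebDensity P =ᵐ[volume] fun x => (p x).toReal := by
    have h := Measure.rnDeriv_withDensity (volume : Measure (Config d N)) hpm
    rw [← hP] at h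
    filter_upwards [h] with x hx
    rw [lebDensity, hx]
  obtain ⟨C, hC⟩ : ∃ C : ℝ, ∀ x, |Real.log ((N ! : ℝ) * (g x).toReal)| ≤ C := by
    obtain ⟨C, hC⟩ := (hgf.image fun a => |Real.log ((N ! : ℝ) * a.toReal)|).bddAbove
    exact ⟨C, fun x => hC ⟨g x, mem_range_self x, rfl⟩⟩
  -- Where `p` vanishes both sides are `0`; elsewhere the logarithm splits into that of `N! g` and
  -- one term per particle.
  have hpt : ∀ x, ENNReal.ofReal |(p x).toReal * Real.log ((N ! : ℝ) * (p x).toReal)| ≤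
      p x * (ENNReal.ofReal C + ∑ i, ENNReal.ofReal |Real.log (r (x i))|) := by
    intro x
    have hpx : p x ≠ ⊤ :=
      ENNReal.mul_ne_top (hgt x) (ENNReal.prod_ne_top fun i _ => ENNReal.ofReal_ne_top)
    by_cases h0 : p x = 0
    · simp [h0]
    have hg0 : g x ≠ 0 := left_ne_zero_of_mul h0
    have hri : ∀ i, r (x i) ≠ 0 := by
      intro i hi
      exact right_ne_zero_of_mul h0 (Finset.prod_eq_zero (Finset.mem_univ i) (by simp [hi]))
    have hgr : (g x).toReal ≠ 0 := ENNReal.toReal_ne_zero.2 ⟨hg0, hgt x⟩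
    have hN : (N ! : ℝ) ≠ 0 := by positivity
    have hpr : (p x).toReal = (g x).toReal * ∏ i, r (x i) := by
      simp [hp, ENNReal.toReal_mul, ENNReal.toReal_prod, hr0]
    have hbound : |Real.log ((N ! : ℝ) * (p x).toReal)| ≤ C + ∑ i, |Real.log (r (x i))| := by
      rw [hpr, ← mul_assoc, Real.log_mul (mul_ne_zero hN hgr)
        (Finset.prod_ne_zero_iff.2 fun i _ => hri i), Real.log_prod fun i _ => hri i]
      exact (abs_add_le _ _).trans (add_le_add (hC x) (Finset.abs_sum_le_sum_abs _ _))
    have hC0 : 0 ≤ C := (abs_nonneg _).trans (hC x)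
    rw [abs_mul, abs_of_nonneg ENNReal.toReal_nonneg, ENNReal.ofReal_mul ENNReal.toReal_nonneg,
      ENNReal.ofReal_toReal hpx, ← ENNReal.ofReal_sum_of_nonneg fun i _ => abs_nonneg _,
      ← ENNReal.ofReal_add hC0 (Finset.sum_nonneg fun i _ => abs_nonneg _)]
    gcongr
  have hum : Measurable fun y => ENNReal.ofReal |Real.log (r y)| :=
    (Real.measurable_log.comp hr).abs.ennreal_ofReal
  have hsm : Measurable fun x : Config d N =>
      ENNReal.ofReal C + ∑ i, ENNReal.ofReal |Real.log (r (x i))| :=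
    measurable_const.add (Finset.measurable_sum _ fun i _ => hum.comp (measurable_pi_apply i))
  have hfin : ∫⁻ x, ENNReal.ofReal |(p x).toReal * Real.log ((N ! : ℝ) * (p x).toReal)| ≠ ⊤ := by
    refine ne_top_of_le_ne_top ?_ (lintegral_mono hpt)
    -- Integrating against `p` is integrating against `P`, and the sum over particles then becomes
    -- an integral against the one-body density.
    have h := lintegral_withDensity_eq_lintegral_mul (volume : Measure (Config d N)) hpm hsm
    rw [← hP, lintegral_add_left measurable_const, ← lintegral_oneBody P hum] at h
    simp only [Pi.mul_apply] at h
    rw [← h]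
    exact ENNReal.add_ne_top.2 ⟨by simp, hlog⟩
  have hcongr := eintegral_congr_ae (μ := (volume : Measure (Config d N)))
    (f := fun x => ((lebDensity P x * Real.log ((N ! : ℝ) * lebDensity P x) : ℝ) : EReal))
    (g := fun x => (((p x).toReal * Real.log ((N ! : ℝ) * (p x).toReal) : ℝ) : EReal))
    (by filter_upwards [hleb] with x hx; rw [hx])
  obtain ⟨h1, h2⟩ := eintegral_coe_ne_bot_top hfin
  rw [entropy, if_pos hac, hcongr]
  exact ⟨by rwa [Ne, EReal.neg_eq_bot_iff], by rwa [Ne, EReal.neg_eq_top_iff]⟩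

/-- Separated states have finite interaction energy for potentials without hard core. -/
theorem interaction_lt_top {d N : ℕ} {P : Measure (Config d N)} [IsProbabilityMeasure P]
    {δ : ℝ} (hδ : 0 < δ) (hP : IsSeparated P δ) {w : Space d → EReal} {κ : ℝ} {α : ℝ≥0∞}
    (hα : α < ⊤) (hw : IsUpperRegular w κ α) : interaction w P < ⊤ := by
  obtain ⟨r₀, s, -, -, hw⟩ := hw
  -- The core profile is at most its power law at `|x| = δ`, finite since `δ > 0` and `α < ∞`; the
  -- tail is at most `1`.
  set K : ℝ≥0∞ :=
    ENNReal.ofReal κ * ((ENNReal.ofReal r₀ / ENNReal.ofReal δ) ^ α.toReal + 1) with hK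
  have hKt : K ≠ ⊤ := by
    refine ENNReal.mul_ne_top ENNReal.ofReal_ne_top (ENNReal.add_ne_top.2 ⟨?_, ENNReal.one_ne_top⟩)
    exact ENNReal.rpow_ne_top_of_nonneg ENNReal.toReal_nonneg
      (ENNReal.div_ne_top ENNReal.ofReal_ne_top (by simpa using hδ))
  have hwK : ∀ x, δ ≤ ‖x‖ → w x ≤ (K : EReal) := by
    intro x hx
    refine (hw x).trans (EReal.coe_ennreal_le_coe_ennreal_iff.2 ?_)
    rw [hK]
    gcongr
    · unfold coreProfile
      rw [if_neg hα.ne]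
      split_ifs
      · gcongr
      · exact zero_le
    · rw [ENNReal.ofReal_le_one]
      have : 0 ≤ ‖x‖ ^ s := by positivity
      exact div_le_one_of_le₀ (by linarith) (by linarith)
  set M : ℝ≥0∞ := ∑ j : Fin N, ∑ k ∈ Finset.Ioi j, K with hM
  have hMt : M ≠ ⊤ := ENNReal.sum_ne_top.2 fun _ _ => ENNReal.sum_ne_top.2 fun _ _ => hKt
  have hMe : (M : EReal) = ∑ j : Fin N, ∑ k ∈ Finset.Ioi j, (K : EReal) := by
    rw [hM]
    let e : ℝ≥0∞ →+ EReal := ⟨⟨(↑), EReal.coe_ennreal_zero⟩, EReal.coe_ennreal_add⟩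
    exact (map_sum e _ _).trans (Finset.sum_congr rfl fun _ _ => map_sum e _ _)
  have hle : ∫⁻ x, (pairEnergy w x).toENNReal ∂P ≤ M := by
    calc ∫⁻ x, (pairEnergy w x).toENNReal ∂P ≤ ∫⁻ _, M ∂P := by
          refine lintegral_mono_ae ?_
          filter_upwards [hP] with x hx
          rw [← EReal.toENNReal_coe (x := M)]
          refine EReal.toENNReal_le_toENNReal ?_
          rw [hMe]
          exact Finset.sum_le_sum fun j _ => Finset.sum_le_sum fun k hk =>
            hwK _ (hx j k (Finset.mem_Ioi.1 hk).ne)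
      _ = M := by simp
  have hlt : ∫⁻ x, (pairEnergy w x).toENNReal ∂P ≠ ⊤ := ne_top_of_le_ne_top hMt hle
  unfold interaction eintegral
  rw [sub_eq_add_neg]
  -- An infinite negative part could only lower the value to `⊥`, so bounding the positive part
  -- suffices.
  refine EReal.add_lt_top ?_ ?_
  · simpa using hlt
  · rw [Ne, EReal.neg_eq_top_iff]
    exact EReal.coe_ennreal_ne_bot _

/-- The condition `hT` keeps `-T * entropy P` away from `⊤`; it is automatic at `T = 0`, where the
product is `0` even for entropy `⊥`. -/
theorem minFreeEnergy_lt_top {d N : ℕ} {ρ : Space d → ℝ} {P : Measure (Config d N)}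
    (hPρ : IsStateOf ρ P) {δ : ℝ} (hδ : 0 < δ) (hP : IsSeparated P δ) {w : Space d → EReal}
    {α : ℝ≥0∞} (hα : α < ⊤) (hw : IsShortRange w α) {T : ℝ}
    (hT : ((T : EReal) * entropy P) ≠ ⊥) : minFreeEnergy N w T ρ < ⊤ := by
  obtain ⟨κ, -, -, hreg⟩ := hw.bounds
  have := hPρ.prob
  refine (iInf₂_le P hPρ).trans_lt ?_
  unfold freeEnergy
  rw [sub_eq_add_neg]
  refine EReal.add_lt_top (interaction_lt_top hδ hP hα hreg).ne ?_
  rwa [Ne, EReal.neg_eq_top_iff]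

/-! ### Construction of the separated state and conclusion. -/

/-- Every integrable density of integer mass has a separated state, of finite entropy if
`ρ log ρ` is integrable. -/
theorem exists_separated_state {d : ℕ} (hd : 1 ≤ d) (N : ℕ) {ρ : Space d → ℝ}
    (hρ_nonneg : 0 ≤ᵐ[volume] ρ) (hρ_int : Integrable ρ volume) (hρ_mass : ∫ x, ρ x = (N : ℝ)) :
    ∃ P : Measure (Config d N), IsStateOf ρ P ∧ (∃ δ : ℝ, 0 < δ ∧ IsSeparated P δ) ∧
      (Integrable (fun x => ρ x * |Real.log (ρ x)|) volume →
        entropy P ≠ ⊥ ∧ entropy P ≠ ⊤) := by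
  -- Pass to a measurable, everywhere non-negative version of `ρ`.
  obtain ⟨r, hr, hr0, hrρ⟩ : ∃ r : Space d → ℝ, Measurable r ∧ (∀ x, 0 ≤ r x) ∧ ρ =ᵐ[volume] r := by
    have hm := hρ_int.aestronglyMeasurable.aemeasurable
    refine ⟨fun x => max (hm.mk ρ x) 0, hm.measurable_mk.max measurable_const,
      fun x => le_max_right _ _, ?_⟩
    filter_upwards [hm.ae_eq_mk, hρ_nonneg] with x hx h0
    rw [← hx]
    exact (max_eq_left h0).symm
  set f : Space d → ℝ≥0∞ := fun x => ENNReal.ofReal (r x) with hf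
  have hfm : Measurable f := hr.ennreal_ofReal
  set μ : Measure (Space d) := volume.withDensity f with hμ
  have hμρ : volume.withDensity (fun x => ENNReal.ofReal (ρ x)) = μ := by
    refine withDensity_congr_ae ?_
    filter_upwards [hrρ] with x hx
    rw [hx]
  have hμN : μ univ = N := by
    rw [← hμρ, withDensity_apply _ MeasurableSet.univ, Measure.restrict_univ,
      ← ofReal_integral_eq_lintegral_ofReal hρ_int hρ_nonneg, hρ_mass, ENNReal.ofReal_natCast]
  obtain ⟨S, hS, hμS, hsum, δ, hδ, hsep⟩ :=
    exists_slabs hd N μ (withDensity_absolutelyContinuous _ _) hμN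
  -- `m = 0` selects the even slabs and `m = 1` the odd ones, so distinct indices differ by at least
  -- two; the factor `2` normalizes the mass `1/2`.
  let S' : Fin 2 → Fin N → Set (Space d) := fun m i => S (2 * i + m)
  let ν : Fin 2 → Fin N → Measure (Space d) := fun m i => (2 : ℝ≥0∞) • μ.restrict (S' m i)
  have hprob : ∀ m i, IsProbabilityMeasure (ν m i) := fun m i => ⟨by
    simp [ν, S', hμS (2 * i + m) (by omega), ENNReal.mul_inv_cancel]⟩
  have hpm := isProbabilityMeasure_permMixture ν
  have hone : oneBody (permMixture ν) = μ := by
    rw [oneBody_permMixture]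
    have hre : ∀ g : ℕ → Measure (Space d), ∀ n : ℕ,
        ∑ m : Fin 2, ∑ i : Fin n, g (2 * i + m) = ∑ k ∈ Finset.range (2 * n), g k := by
      intro g n
      induction n with
      | zero => simp
      | succ n ih =>
        rw [show 2 * (n + 1) = 2 * n + 1 + 1 by ring, Finset.sum_range_succ, Finset.sum_range_succ,
          ← ih]
        rw [Fin.sum_univ_two, Fin.sum_univ_two, Fin.sum_univ_castSucc, Fin.sum_univ_castSucc]
        simp only [Fin.val_castSucc, Fin.val_last, Fin.val_zero, Fin.val_one, add_zero]
        abel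
    simp only [ν, S']
    rw [hre (fun k => (2 : ℝ≥0∞) • μ.restrict (S k)) N, ← Finset.smul_sum, hsum, smul_smul]
    simp [ENNReal.inv_mul_cancel]
  refine ⟨permMixture ν, ⟨hpm, isSymmetric_permMixture ν, by rw [hone, hμρ]⟩, ⟨δ, hδ, ?_⟩, ?_⟩
  · refine isSeparated_permMixture (S := S') (fun m i => ?_) fun m i j hij x hx y hy => ?_
    · exact Measure.ae_smul_measure (ae_restrict_mem (hS _)) _
    · have : (i : ℕ) < j := hij
      exact hsep _ _ (by omega) (by omega) x hx y hy
  · intro hlog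
    refine entropy_ne_bot_top hr hr0 (measurable_mixtureFactor (fun m i => hS _) 2)
      (mixtureFactor_ne_top S' (by simp)) (finite_range_mixtureFactor S' 2)
      (permMixture_eq_withDensity hfm (fun m i => hS _) fun m i => rfl) ?_
    have hum : Measurable fun y => ENNReal.ofReal |Real.log (r y)| :=
      (Real.measurable_log.comp hr).abs.ennreal_ofReal
    rw [hone, hμ, lintegral_withDensity_eq_lintegral_mul _ hfm hum]
    refine ne_top_of_le_ne_top hlog.lintegral_lt_top.ne (lintegral_mono_ae ?_)
    filter_upwards [hrρ] with x hx
    rw [hx, ENNReal.ofReal_mul (hr0 x)]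
    rfl

end ClassicalGas

end

theorem theorem2p1 (d : ℕ) (hd : 1 ≤ d) (N : ℕ) (ρ : ClassicalGas.Space d → ℝ)
    (hρ_nonneg : 0 ≤ᵐ[volume] ρ) (hρ_int : Integrable ρ volume)
    (hρ_mass : ∫ x, ρ x = (N : ℝ)) :
    (∃ P : Measure (ClassicalGas.Config d N), ClassicalGas.IsStateOf ρ P ∧
      ∃ δ : ℝ, 0 < δ ∧ ClassicalGas.IsSeparated P δ) ∧
    (∀ (w : ClassicalGas.Space d → EReal) (α : ℝ≥0∞), α < ⊤ →
      ClassicalGas.IsShortRange w α →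
      ClassicalGas.minFreeEnergy N w 0 ρ < ⊤) ∧
    (Integrable (fun x => ρ x * |Real.log (ρ x)|) volume →
      (∃ P : Measure (ClassicalGas.Config d N), ClassicalGas.IsStateOf ρ P ∧
        (∃ δ : ℝ, 0 < δ ∧ ClassicalGas.IsSeparated P δ) ∧
        ClassicalGas.entropy P ≠ ⊥ ∧ ClassicalGas.entropy P ≠ ⊤) ∧
      ∀ (w : ClassicalGas.Space d → EReal) (α : ℝ≥0∞), α < ⊤ →
        ClassicalGas.IsShortRange w α →
        ∀ T : ℝ, 0 < T → ClassicalGas.minFreeEnergy N w T ρ < ⊤) := by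
  obtain ⟨P, hP, ⟨δ, hδ, hsep⟩, hent⟩ :=
    ClassicalGas.exists_separated_state hd N hρ_nonneg hρ_int hρ_mass
  refine ⟨⟨P, hP, δ, hδ, hsep⟩, fun w α hα hw => ?_, fun hlog => ?_⟩
  · exact ClassicalGas.minFreeEnergy_lt_top hP hδ hsep hα hw (by simp)
  · obtain ⟨h1, h2⟩ := hent hlog
    refine ⟨⟨P, hP, ⟨δ, hδ, hsep⟩, h1, h2⟩, fun w α hα hw T _ => ?_⟩
    refine ClassicalGas.minFreeEnergy_lt_top hP hδ hsep hα hw ?_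
    lift ClassicalGas.entropy P to ℝ using ⟨h2, h1⟩ with e
    exact_mod_cast EReal.coe_ne_bot (T * e)
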